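/- Let $L/K$ be a separable algebraic field extension, possibly of infinite degree, let $N\supseteq L$ be a normal closure of $L/K$, and let $G=\operatorname{Gal}(N/K)$. Let $(L_i)_{i\in I}$ be the family of distinct conjugate fields $g(L)$, $g\in G$. Let $\Gamma$ be the groupoid with objects the fields $L_i$, whose morphisms $L_i\to L_j$ are the isomorphisms $g|_{L_i}$ with $g\in G$ and $g(L_i)=L_j$, with composition of maps; $d(\sigma)$ and $r(\sigma)$ denote the domain and range of $\sigma\in\Gamma$, and $\Gamma(L_i)$ the group of morphisms $L_i\to L_i$. For all $\sigma,\tau\in\Gamma$ with $d(\sigma)=r(\tau)$ let $\beta_{\sigma,\tau}\in r(\sigma)\setminus\{0\}$ be given such that $\beta_{\sigma,\mathrm{id}_{d(\sigma)}}=\beta_{\mathrm{id}_{r(\sigma)},\sigma}=1$ for all $\sigma\in\Gamma$, and $$\beta_{\sigma,\tau}\,\beta_{\sigma\tau,\rho}=\sigma(\beta_{\tau,\rho})\,\beta_{\sigma,\tau\rho}\qquad\text{whenever } d(\sigma)=r(\tau)\text{ and } d(\tau)=r(\rho).$$ Let $(L/K,\beta)$ be the (not necessarily unital) ring of formal finite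 sums $\sum_{\sigma\in\Gamma}a_\sigma u_\sigma$ with $a_\sigma\in r(\sigma)$, with componentwise addition and the biadditive multiplication given by $(a u_\sigma)(b u_\tau)=a\,\sigma(b)\,\beta_{\sigma,\tau}\,u_{\sigma\tau}$ if $d(\sigma)=r(\tau)$, and $(a u_\sigma)(b u_\tau)=0$ otherwise. Let $\Delta$ be a wide subgroupoid of $\Gamma$ (that is, one containing all the objects of $\Gamma$), write $\Delta(L_i)$ for the group of morphisms $L_i\to L_i$ in $\Delta$, and let $(L/K,\beta_\Delta)$ be the subring of $(L/K,\beta)$ of all sums $\sum_{\sigma\in\Delta}a_\sigma u_\sigma$. A ring extension $R/S$ (rings not necessarily unital) is called separable if the multiplication map $R\otimes_S R\to R$ has a section that is a homomorphism of $R$-bimodules. **Theorem.** Suppose that for each $j\in I$ the subgroup $\Delta(L_j)$ is closed in $\Gamma(L_j)$ with respect to the Krull topology. Then $(L/K,\beta)/(L/K,\beta_\Delta)$ is separable if and only if there exists $i\in I$ such that $[\Gamma(L_i):\Delta(L_i)]<\infty$. -/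

import Mathlib

open CategoryTheory TensorProduct DirectSum Topology

universe u v w

noncomputable section

/-! ## Separable extensions of (not necessarily unital) rings -/

namespace SepExt

variable {R : Type w} [NonUnitalRing R]

/-- The additive subgroup of `R ⊗[ℤ] R` generated by the elements `(r * s) ⊗ r' - r ⊗ (s * r')`
with `r, r' ∈ R` and `s ∈ S`. -/
def balanced (S : NonUnitalSubring R) : AddSubgroup (R ⊗[ℤ] R) :=
  AddSubgroup.closure {t | ∃ r r' s : R, s ∈ S ∧ t = (r * s) ⊗ₜ[ℤ] r' - r ⊗ₜ[ℤ] (s * r')}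

/-- The tensor product `R ⊗_S R` over a subring `S` of a ring `R`, neither assumed unital. -/
abbrev RelTensor (S : NonUnitalSubring R) : Type w := (R ⊗[ℤ] R) ⧸ balanced S

/-- Left multiplication by `x` on `R ⊗[ℤ] R`. -/
def preLeft (x : R) : R ⊗[ℤ] R →+ R ⊗[ℤ] R :=
  (TensorProduct.map (AddMonoidHom.mulLeft x).toIntLinearMap LinearMap.id).toAddMonoidHom

/-- Right multiplication by `x` on `R ⊗[ℤ] R`. -/
def preRight (x : R) : R ⊗[ℤ] R →+ R ⊗[ℤ] R :=
  (TensorProduct.map LinearMap.id (AddMonoidHom.mulRight x).toIntLinearMap).toAddMonoidHom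

/-- Multiplication `R ⊗[ℤ] R → R`. -/
def preMul : R ⊗[ℤ] R →+ R :=
  TensorProduct.liftAddHom AddMonoidHom.mul (fun n r r' => by simp [smul_mul_assoc, mul_smul_comm])

@[simp] lemma preLeft_tmul (x r r' : R) : preLeft x (r ⊗ₜ[ℤ] r') = (x * r) ⊗ₜ[ℤ] r' := rfl

@[simp] lemma preRight_tmul (x r r' : R) : preRight x (r ⊗ₜ[ℤ] r') = r ⊗ₜ[ℤ] (r' * x) := rfl

@[simp] lemma preMul_tmul (r r' : R) : preMul (r ⊗ₜ[ℤ] r') = r * r' := rfl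

lemma balanced_le_preLeft (S : NonUnitalSubring R) (x : R) :
    balanced S ≤ (balanced S).comap (preLeft x) := by
  refine (AddSubgroup.closure_le _).2 ?_
  rintro _ ⟨r, r', s, hs, rfl⟩
  exact AddSubgroup.subset_closure ⟨x * r, r', s, hs, by simp [mul_assoc]⟩

lemma balanced_le_preRight (S : NonUnitalSubring R) (x : R) :
    balanced S ≤ (balanced S).comap (preRight x) := by
  refine (AddSubgroup.closure_le _).2 ?_
  rintro _ ⟨r, r', s, hs, rfl⟩
  exact AddSubgroup.subset_closure ⟨r, r' * x, s, hs, by simp [mul_assoc]⟩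

lemma balanced_le_ker_preMul (S : NonUnitalSubring R) :
    balanced S ≤ (preMul (R := R)).ker := by
  refine (AddSubgroup.closure_le _).2 ?_
  rintro _ ⟨r, r', s, hs, rfl⟩
  simp [AddMonoidHom.mem_ker, mul_assoc]

/-- The left action of `R` on `R ⊗_S R`: `x (r ⊗ r') = (x r) ⊗ r'`. -/
def leftAct (S : NonUnitalSubring R) (x : R) : RelTensor S →+ RelTensor S :=
  QuotientAddGroup.map _ _ (preLeft x) (balanced_le_preLeft S x)

/-- The right action of `R` on `R ⊗_S R`: `(r ⊗ r') x = r ⊗ (r' x)`. -/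
def rightAct (S : NonUnitalSubring R) (x : R) : RelTensor S →+ RelTensor S :=
  QuotientAddGroup.map _ _ (preRight x) (balanced_le_preRight S x)

/-- The multiplication map `μ : R ⊗_S R → R`, `μ (r ⊗ r') = r r'`. -/
def mulMap (S : NonUnitalSubring R) : RelTensor S →+ R :=
  QuotientAddGroup.lift _ preMul (balanced_le_ker_preMul S)

/-- The ring extension `R/S` is separable: the multiplication map `μ : R ⊗_S R → R` has a section
which is a homomorphism of `R`-bimodules. -/
def IsSeparableExt (S : NonUnitalSubring R) : Prop :=
  ∃ δ : R →+ RelTensor S,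
    (∀ x y : R, δ (x * y) = leftAct S x (δ y)) ∧
    (∀ x y : R, δ (x * y) = rightAct S y (δ x)) ∧
    ∀ x : R, mulMap S (δ x) = x

end SepExt

/-! ## Object crossed products -/

/-- An object crossed system over a groupoid. The composite "first `τ`, then `σ`", written `στ` in
the usual notation for maps, is `τ ≫ σ`. -/
structure ObjectCrossedSystem (C : Type u) [Groupoid.{v} C] (A : C → Type w)
    [∀ e, Ring (A e)] where
  /-- the ring isomorphisms `α_σ : A_{d(σ)} → A_{r(σ)}` -/
  α : ∀ {e f : C}, (e ⟶ f) → (A e ≃+* A f)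
  /-- the units `β_{σ,τ} ∈ U(A_{r(σ)})` for `d(σ) = r(τ)` -/
  β : ∀ {e f g : C}, (f ⟶ g) → (e ⟶ f) → (A g)ˣ
  α_id : ∀ (e : C) (a : A e), α (𝟙 e) a = a
  β_id_right : ∀ {e f : C} (σ : e ⟶ f), β σ (𝟙 e) = 1
  β_id_left : ∀ {e f : C} (σ : e ⟶ f), β (𝟙 f) σ = 1
  α_comp : ∀ {e f g : C} (σ : f ⟶ g) (τ : e ⟶ f) (a : A e),
    α σ (α τ a) = (β σ τ : A g) * α (τ ≫ σ) a * ((β σ τ)⁻¹ : (A g)ˣ)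
  β_cocycle : ∀ {e f g h : C} (σ : g ⟶ h) (τ : f ⟶ g) (ρ : e ⟶ f),
    (β σ τ : A h) * (β (τ ≫ σ) ρ : A h) = α σ (β τ ρ : A g) * (β σ (ρ ≫ τ) : A h)

/-- The morphisms of a category, with arbitrary domain and range. -/
structure Mor (C : Type u) [Category.{v} C] where
  dom : C
  ran : C
  hom : dom ⟶ ran

namespace ObjectCrossedSystem

variable {C : Type u} [Groupoid.{v} C] {A : C → Type w} [∀ e, Ring (A e)]

/-- The additive group of the object crossed product: formal finite sums `∑ a_σ u_σ` over the
morphisms `σ`, with `a_σ ∈ A_{r(σ)}`. -/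
def CrossedProduct (_S : ObjectCrossedSystem C A) : Type max u v w := ⨁ p : Mor C, A p.ran

instance (S : ObjectCrossedSystem C A) : AddCommGroup S.CrossedProduct :=
  inferInstanceAs (AddCommGroup (⨁ p : Mor C, A p.ran))

variable (S : ObjectCrossedSystem C A)

/-- `S.single p a` is the element `a u_p`. -/
def single (p : Mor C) : A p.ran →+ S.CrossedProduct := by
  classical exact DirectSum.of (fun p : Mor C => A p.ran) p

/-- The coefficient at `u_p` of an element. -/
def coeff (p : Mor C) : S.CrossedProduct →+ A p.ran :=
  DFinsupp.evalAddMonoidHom (β := fun p : Mor C => A p.ran) p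

variable {S} in
lemma hom_ext {M : Type*} [AddCommMonoid M] {f g : S.CrossedProduct →+ M}
    (h : ∀ p a, f (S.single p a) = g (S.single p a)) : f = g := by
  classical
  exact DirectSum.addHom_ext h

variable {S} in
lemma induction {P : S.CrossedProduct → Prop} (x : S.CrossedProduct) (h0 : P 0)
    (h1 : ∀ p a, P (S.single p a)) (h2 : ∀ x y, P x → P y → P (x + y)) : P x := by
  classical
  exact DirectSum.induction_on x h0 h1 h2

open Classical in
lemma coeff_single (p q : Mor C) (a : A p.ran) :
    S.coeff q (S.single p a) = if h : p = q then h ▸ a else 0 := by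
  exact DirectSum.of_apply (β := fun p : Mor C => A p.ran) (i := p) q a

open Classical in
/-- The product `(a u_p) (b u_q)`. It is zero unless `d(p) = r(q)`. If `d(p) = r(q)`, it is
`a α_p(b) β_{p,q} u_{pq}`; here `eqToHom h`, the identity morphism of the object `r(q) = d(p)`, is
inserted in order that the composite typechecks. -/
def termMul (p q : Mor C) : A p.ran →+ A q.ran →+ S.CrossedProduct :=
  if h : q.ran = p.dom then
    AddMonoidHom.mk' (fun a => (S.single ⟨q.dom, p.ran, q.hom ≫ eqToHom h ≫ p.hom⟩).comp
      ((AddMonoidHom.mulRight (S.β (eqToHom h ≫ p.hom) q.hom : A p.ran)).comp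
        ((AddMonoidHom.mulLeft a).comp (S.α (eqToHom h ≫ p.hom)).toAddMonoidHom)))
      (fun a b => by ext c; simp [add_mul])
  else 0

/-- The multiplication of the object crossed product, the biadditive extension of `termMul`. -/
def mulHom : S.CrossedProduct →+ S.CrossedProduct →+ S.CrossedProduct := by
  classical
  exact DirectSum.toAddMonoid (β := fun p : Mor C => A p.ran) fun p =>
    (DirectSum.toAddMonoid (β := fun p : Mor C => A p.ran) fun q => (S.termMul p q).flip).flip

instance : Mul S.CrossedProduct := ⟨fun x y => S.mulHom x y⟩

lemma mul_def (x y : S.CrossedProduct) : x * y = S.mulHom x y := rfl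

lemma mulHom_single (p q : Mor C) (a : A p.ran) (b : A q.ran) :
    S.mulHom (S.single p a) (S.single q b) = S.termMul p q a b := by
  classical
  have h := DirectSum.toAddMonoid_of (β := fun p : Mor C => A p.ran) (fun p =>
    (DirectSum.toAddMonoid (β := fun p : Mor C => A p.ran) fun q => (S.termMul p q).flip).flip) p a
  exact (DFunLike.congr_fun h (S.single q b)).trans (DFunLike.congr_fun
    (DirectSum.toAddMonoid_of (β := fun p : Mor C => A p.ran)
      (fun q => (S.termMul p q).flip) q b) a)

/-- `(a u_σ) (b u_τ) = a α_σ(b) β_{σ,τ} u_{στ}` for composable `σ` and `τ`. -/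
lemma single_mul_single {e f g : C} (σ : f ⟶ g) (τ : e ⟶ f) (a : A g) (b : A f) :
    S.single ⟨f, g, σ⟩ a * S.single ⟨e, f, τ⟩ b =
      S.single ⟨e, g, τ ≫ σ⟩ (a * S.α σ b * (S.β σ τ : A g)) := by
  rw [mul_def, mulHom_single, termMul, dif_pos rfl]
  change S.single ⟨e, g, τ ≫ 𝟙 f ≫ σ⟩ (a * S.α (𝟙 f ≫ σ) b * (S.β (𝟙 f ≫ σ) τ : A g)) = _
  rw [Category.id_comp]

/-- `(a u_p) (b u_q) = 0` if `p` and `q` are not composable. -/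
lemma single_mul_single_of_ne (p q : Mor C) (h : q.ran ≠ p.dom) (a : A p.ran) (b : A q.ran) :
    S.single p a * S.single q b = 0 := by
  rw [mul_def, mulHom_single, termMul, dif_neg h]
  rfl

lemma single_mul_assoc (p q r : Mor C) (a : A p.ran) (b : A q.ran) (c : A r.ran) :
    S.single p a * S.single q b * S.single r c = S.single p a * (S.single q b * S.single r c) := by
  have z1 : ∀ x : S.CrossedProduct, 0 * x = 0 := fun x => by simp [mul_def]
  have z2 : ∀ x : S.CrossedProduct, x * 0 = 0 := fun x => by simp [mul_def]
  obtain ⟨g, h, σ⟩ := p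
  obtain ⟨f, g', τ⟩ := q
  obtain ⟨e, f', ρ⟩ := r
  by_cases h1 : g' = g
  · subst h1
    by_cases h2 : f' = f
    · subst h2
      rw [single_mul_single, single_mul_single, single_mul_single, single_mul_single,
        Category.assoc]
      congr 1
      have h3 : S.α σ (S.α τ c) * (S.β σ τ : A h) = (S.β σ τ : A h) * S.α (τ ≫ σ) c := by
        rw [S.α_comp]; simp [mul_assoc]
      have h4 := S.β_cocycle σ τ ρ
      simp only [map_mul, mul_assoc]
      rw [← h4, ← mul_assoc (S.α σ (S.α τ c)), h3]
      simp only [mul_assoc]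
    · rw [single_mul_single, single_mul_single_of_ne _ _ _ h2, single_mul_single_of_ne _ _ _ h2, z2]
  · rw [single_mul_single_of_ne _ _ _ h1, z1]
    by_cases h2 : f' = f
    · subst h2
      rw [single_mul_single, single_mul_single_of_ne _ _ _ h1]
    · rw [single_mul_single_of_ne S ⟨f, g', τ⟩ ⟨e, f', ρ⟩ h2, z2]

/-- The object crossed product as a ring (in general without a unit). -/
instance : NonUnitalRing S.CrossedProduct where
  left_distrib x y z := by simp [mul_def]
  right_distrib x y z := by simp [mul_def]
  zero_mul x := by simp [mul_def]
  mul_zero x := by simp [mul_def]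
  mul_assoc x y z := by
    have ad : ∀ x y z : S.CrossedProduct, x * (y + z) = x * y + x * z := fun x y z => by
      simp [mul_def]
    have da : ∀ x y z : S.CrossedProduct, (x + y) * z = x * z + y * z := fun x y z => by
      simp [mul_def]
    have z1 : ∀ x : S.CrossedProduct, 0 * x = 0 := fun x => by simp [mul_def]
    have z2 : ∀ x : S.CrossedProduct, x * 0 = 0 := fun x => by simp [mul_def]
    induction x using induction with
    | h0 => simp only [z1]
    | h2 x x' hx hx' => simp only [da, hx, hx']
    | h1 p a =>
      induction y using induction with
      | h0 => simp only [z1, z2]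
      | h2 x x' hx hx' => simp only [ad, da, hx, hx']
      | h1 q b =>
        induction z using induction with
        | h0 => simp only [z2]
        | h2 x x' hx hx' => simp only [ad, hx, hx']
        | h1 r c => exact S.single_mul_assoc p q r a b c

lemma mem_of_single_mem {D : Set (Mor C)} {T : AddSubgroup S.CrossedProduct}
    (hT : ∀ p ∈ D, ∀ a, S.single p a ∈ T) (x : S.CrossedProduct)
    (hx : ∀ p, S.coeff p x ≠ 0 → p ∈ D) : x ∈ T := by
  classical
  have key : ∀ y : S.CrossedProduct,
      (DFinsupp.filter (· ∈ D) (y : Π₀ p : Mor C, A p.ran) : S.CrossedProduct) ∈ T := by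
    intro y
    induction y using induction with
    | h0 => exact (DFinsupp.filter_zero (β := fun p : Mor C => A p.ran) (· ∈ D)).symm ▸ T.zero_mem
    | h2 y z hy hz =>
      exact (DFinsupp.filter_add (β := fun p : Mor C => A p.ran) (· ∈ D) y z).symm ▸
        T.add_mem hy hz
    | h1 p a =>
      have h := DFinsupp.filter_single (β := fun p : Mor C => A p.ran) (· ∈ D) p a
      by_cases hp : p ∈ D
      · rw [if_pos hp] at h
        exact h.symm ▸ hT p hp a
      · rw [if_neg hp] at h
        exact h.symm ▸ T.zero_mem
  have e : (DFinsupp.filter (· ∈ D) (x : Π₀ p : Mor C, A p.ran) : S.CrossedProduct) = x := by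
    refine DFinsupp.ext fun p => ?_
    refine (DFinsupp.filter_apply (β := fun p : Mor C => A p.ran) (· ∈ D) p x).trans ?_
    split_ifs with h
    · rfl
    · by_contra h'
      exact h (hx p fun h0 => h' h0.symm)
  exact e ▸ key x

/-- For a subgroupoid `Δ` of the groupoid, the subring of all finite sums `∑ a_σ u_σ` over the
morphisms `σ` of `Δ`. It is the object crossed product of the restriction of the system to `Δ`,
regarded as a subring of the object crossed product of the system. -/
def subring (Δ : Subgroupoid C) : NonUnitalSubring S.CrossedProduct where
  carrier := {x | ∀ p : Mor C, S.coeff p x ≠ 0 → p.hom ∈ Δ.arrows p.dom p.ran}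
  zero_mem' := fun p hp => absurd (map_zero _) hp
  add_mem' := by
    intro x y hx hy p hp
    by_contra h
    exact hp (by
      rw [map_add, not_imp_comm.1 (hx p) h, not_imp_comm.1 (hy p) h, add_zero])
  neg_mem' := by
    intro x hx p hp
    exact hx p fun h => hp (by rw [map_neg, h, neg_zero])
  mul_mem' := by
    intro x y hx hy
    let T : AddSubgroup S.CrossedProduct :=
      { carrier := {x | ∀ p : Mor C, S.coeff p x ≠ 0 → p.hom ∈ Δ.arrows p.dom p.ran}
        zero_mem' := fun p hp => absurd (map_zero _) hp
        add_mem' := by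
          intro x y hx hy p hp
          by_contra h
          exact hp (by
            rw [map_add, not_imp_comm.1 (hx p) h, not_imp_comm.1 (hy p) h, add_zero])
        neg_mem' := by
          intro x hx p hp
          exact hx p fun h => hp (by rw [map_neg, h, neg_zero]) }
    have hs : ∀ p : Mor C, p.hom ∈ Δ.arrows p.dom p.ran → ∀ a, S.single p a ∈ T := by
      intro p hp a q hq
      rw [coeff_single] at hq
      by_cases h : p = q
      · exact h ▸ hp
      · exact absurd (dif_neg h) hq
    refine S.mem_of_single_mem (D := {p | p.hom ∈ Δ.arrows p.dom p.ran})
      (T := T.comap (AddMonoidHom.mulRight y)) (fun p hp a => ?_) x hx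
    refine S.mem_of_single_mem (D := {p | p.hom ∈ Δ.arrows p.dom p.ran})
      (T := T.comap (AddMonoidHom.mulLeft (S.single p a))) (fun q hq b => ?_) y hy
    change S.single p a * S.single q b ∈ T
    obtain ⟨f, g, σ⟩ := p
    obtain ⟨e, f', τ⟩ := q
    by_cases h : f' = f
    · subst h
      rw [single_mul_single]
      exact hs _ (Δ.mul hq hp) _
    · rw [single_mul_single_of_ne _ _ _ h]
      exact T.zero_mem

end ObjectCrossedSystem

/-! ## The groupoid of conjugate fields and its object crossed products -/

section Conjugates

variable {K : Type u} {N : Type v} [Field K] [Field N] [Algebra K N]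

/-- The distinct conjugate fields `g(L)`, `g ∈ Gal(N/K)`, of an intermediate field `L` of `N/K`. -/
structure ConjField (L : IntermediateField K N) where
  field : IntermediateField K N
  conj : ∃ g : N ≃ₐ[K] N, L.map (g : N →ₐ[K] N) = field

variable {L : IntermediateField K N}

/-- Morphisms `E → F` of the groupoid of conjugate fields: the isomorphisms `g|_E : E → F`, where
`g ∈ Gal(N/K)` and `g(E) = F`. -/
structure ConjField.Hom (E F : ConjField L) where
  equiv : E.field ≃ₐ[K] F.field
  restrict : ∃ g : N ≃ₐ[K] N, ∀ x : E.field, g (x : N) = (equiv x : N)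

@[ext] lemma ConjField.Hom.ext' {E F : ConjField L} {σ τ : ConjField.Hom E F}
    (h : ∀ x, σ.equiv x = τ.equiv x) : σ = τ := by
  cases σ; cases τ; congr 1; exact AlgEquiv.ext h

/-- The groupoid of conjugate fields. Composition is composition of maps. -/
instance : Groupoid (ConjField L) where
  Hom E F := ConjField.Hom E F
  id E := ⟨AlgEquiv.refl, AlgEquiv.refl, fun _ => rfl⟩
  comp σ τ := ⟨σ.equiv.trans τ.equiv, by
    obtain ⟨g, hg⟩ := σ.restrict
    obtain ⟨h, hh⟩ := τ.restrict
    exact ⟨g.trans h, fun x => by simp [hg, hh]⟩⟩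
  inv σ := ⟨σ.equiv.symm, by
    obtain ⟨g, hg⟩ := σ.restrict
    refine ⟨g.symm, fun x => ?_⟩
    rw [AlgEquiv.symm_apply_eq, hg]
    simp⟩
  id_comp _ := rfl
  comp_id _ := rfl
  assoc _ _ _ := rfl
  inv_comp _ := ConjField.Hom.ext' fun x => AlgEquiv.apply_symm_apply _ x
  comp_inv _ := ConjField.Hom.ext' fun x => AlgEquiv.symm_apply_apply _ x

/-- The isomorphism of fields underlying a morphism of the groupoid of conjugate fields. -/
def ConjField.toEquiv {E F : ConjField L} (σ : E ⟶ F) : E.field ≃ₐ[K] F.field :=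
  ConjField.Hom.equiv σ

/-- The Krull topology on the isotropy group `Γ(E)`: the topology induced by the Krull topology of
the group of all `K`-automorphisms of the field `E`. -/
@[reducible]
def ConjField.krull (E : ConjField L) : TopologicalSpace (E ⟶ E) :=
  TopologicalSpace.induced ConjField.toEquiv (krullTopology K E.field)

variable (L) in
/-- A family of nonzero elements `β_{σ,τ} ∈ r(σ)`, indexed by the pairs of composable morphisms of
the groupoid of conjugate fields, which is normalized and satisfies the cocycle identity. -/
structure ConjCocycle where
  β : ∀ {E F G : ConjField L}, (F ⟶ G) → (E ⟶ F) → G.field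
  β_ne_zero : ∀ {E F G : ConjField L} (σ : F ⟶ G) (τ : E ⟶ F), β σ τ ≠ 0
  β_id_right : ∀ {E F : ConjField L} (σ : E ⟶ F), β σ (𝟙 E) = 1
  β_id_left : ∀ {E F : ConjField L} (σ : E ⟶ F), β (𝟙 F) σ = 1
  β_cocycle : ∀ {E F G H : ConjField L} (σ : G ⟶ H) (τ : F ⟶ G) (ρ : E ⟶ F),
    β σ τ * β (τ ≫ σ) ρ = ConjField.toEquiv σ (β τ ρ) * β σ (ρ ≫ τ)

/-- The object crossed system with rings the conjugate fields, `α_σ = σ`, and the given `β`. Its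
object crossed product is `(L/K, β)`. -/
def ConjCocycle.system (b : ConjCocycle L) :
    ObjectCrossedSystem (ConjField L) (fun E => E.field) where
  α σ := (ConjField.toEquiv σ).toRingEquiv
  β σ τ := Units.mk0 (b.β σ τ) (b.β_ne_zero σ τ)
  α_id _ _ := rfl
  β_id_right σ := Units.ext (b.β_id_right σ)
  β_id_left σ := Units.ext (b.β_id_left σ)
  α_comp σ τ a := by
    rw [mul_comm, ← mul_assoc, Units.inv_mul, one_mul]
    rfl
  β_cocycle σ τ ρ := b.β_cocycle σ τ ρ

end Conjugates

end

/-! Write `R` for the crossed product, `S` for the subring given by `Δ`, and `1_e` for the unit of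
the coefficient ring at an object `e`. A bimodule section `δ` is determined by the elements `x_e =
δ(1_e)`. They satisfy `r x_d = x_e r` for `r` homogeneous of degree `d ⟶ e`, and `x_e` multiplies
out to `1_e`. The family `(x_e)` plays the role of a separability idempotent, since `R` need not
have a unit.

Necessity (`exists_finiteIndex_of_isSeparableExt`): sending `r ⊗ r'`, with `r` homogeneous of degree
`p`, to the coset `pΔ` weighted by the coefficient of `r r'` at the identity of `e` is well defined
on `R ⊗_S R`, because `pδΔ = pΔ`. Applied to `x_e` it gives a finitely supported function on cosets
with sum `1`, hence nonzero. Commutation with `u_σ` for `σ` in the isotropy group of `e` makes the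
support stable under translation. If `τΔ` is in the support, `τ : f ⟶ e`, then so is every `τγΔ`
with `γ ∈ Γ(f)`; there are `[Γ(f) : Δ(f)]` of these, so the index is finite.

Sufficiency (`isSeparableExt_of_sum_eq_one`): let `H = Δ(f)` have finite index. As `H` is closed, it
contains every morphism that fixes its fixed field (`mem_closure_of_fixes_fixed`), so distinct
cosets restrict to distinct embeddings of that field. Dedekind's independence of characters then
yields an `H`-fixed `x` of trace `1` (`exists_fixed_sum_out_smul_eq_one`). Put `x_e = ∑ u_τ x ⊗
u_τ⁻¹`, where `τ` runs over representatives of the classes of morphisms `f ⟶ e` modulo `H`. -/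

noncomputable section

/-! ## Elements of trace one -/

section Trace

open MulAction in
/-- If a subgroup `H` of finite index is determined by its fixed elements, then there is an element
fixed by `H` whose trace along `G / H` is one. -/
theorem exists_fixed_sum_out_smul_eq_one {G M : Type*} [Group G] [Field M] [MulSemiringAction G M]
    (H : Subgroup G) [Fintype (G ⧸ H)]
    (hH : ∀ g : G, (∀ x ∈ fixedPoints H M, g • x = x) → g ∈ H) :
    ∃ x ∈ fixedPoints H M, ∑ q : G ⧸ H, q.out • x = 1 := by
  let F : Subfield M := FixedPoints.subfield H M
  -- On elements fixed by `H` the action depends only on the coset, so the choice of representatives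
  -- is harmless.
  have out_smul : ∀ (g : G) (x : M), x ∈ fixedPoints H M →
      (g : G ⧸ H).out • x = g • x := by
    intro g x hx
    obtain ⟨h, hh⟩ := QuotientGroup.mk_out_eq_mul H g
    rw [hh, mul_smul]
    congr 1
    exact hx h
  let χ : G ⧸ H → (F →* M) := fun q =>
    ((MulSemiringAction.toRingHom G M q.out).comp F.subtype : F →+* M)
  have hχ : ∀ q (x : F), χ q x = q.out • (x : M) := fun _ _ => rfl
  have inj : Function.Injective χ := by
    intro q r h
    have : q.out⁻¹ * r.out ∈ H := by
      refine hH _ fun x hx => ?_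
      have := DFunLike.congr_fun h ⟨x, hx⟩
      rw [hχ, hχ] at this
      rw [mul_smul, inv_smul_eq_iff]
      exact this.symm
    rw [← QuotientGroup.out_eq' q, ← QuotientGroup.out_eq' r]
    exact QuotientGroup.eq.2 this
  -- Dedekind: distinct characters of the fixed field are linearly independent, so their sum, the
  -- trace, is not identically zero.
  have li := (linearIndependent_monoidHom F M).comp χ inj
  obtain ⟨x, hx⟩ : ∃ x : F, ∑ q : G ⧸ H, q.out • (x : M) ≠ 0 := by
    by_contra! h
    have := Fintype.linearIndependent_iff.1 li (fun _ => 1) (by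
      funext x
      simpa [hχ] using h x) ((1 : G) : G ⧸ H)
    exact one_ne_zero this
  set y := ∑ q : G ⧸ H, q.out • (x : M) with hy
  have inv : ∀ g : G, g • y = y := by
    intro g
    rw [hy, Finset.smul_sum]
    refine Fintype.sum_equiv (MulAction.toPerm g) _ _ fun q => ?_
    rw [← mul_smul, ← out_smul (g * q.out) x x.2]
    congr 2
    rw [MulAction.toPerm_apply]
    conv_rhs => rw [← QuotientGroup.out_eq' q]
    rfl
  -- The trace `y` is fixed by all of `G`, so dividing by it preserves `H`-invariance and rescales
  -- the trace to one.
  refine ⟨x * y⁻¹, fun h => ?_, ?_⟩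
  · have h1 : h • (x : M) = x := x.2 h
    have h2 : h • y = y := inv h
    rw [smul_mul', smul_inv'', h1, h2]
  · simp only [smul_mul', smul_inv'', inv]
    rw [← Finset.sum_mul, ← hy, mul_inv_cancel₀ hx]

/-- An automorphism of a separable algebraic extension which fixes all elements fixed by a subgroup
`D` lies in the closure of `D`. -/
theorem mem_closure_of_fixes_fixed {K M : Type*} [Field K] [Field M] [Algebra K M]
    [Algebra.IsSeparable K M] (D : Subgroup (M ≃ₐ[K] M)) (σ : M ≃ₐ[K] M)
    (h : ∀ x : M, (∀ d ∈ D, d x = x) → σ x = x) :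
    σ ∈ closure (D : Set (M ≃ₐ[K] M)) := by
  rw [mem_closure_iff_nhds]
  -- `M/K` need not be normal, so the orbit of a primitive element replaces the Galois
  -- correspondence. A neighbourhood of `σ` contains all `σρ` with `ρ` fixing some finite
  -- subextension `E = K(θ)`; it suffices to find `d ∈ D` with `d θ = σ θ`.
  intro t ht
  have ht' : (fun τ => σ * τ) ⁻¹' t ∈ 𝓝 (1 : M ≃ₐ[K] M) :=
    (continuous_const_mul σ).continuousAt.preimage_mem_nhds (by simpa using ht)
  obtain ⟨E, _, hE⟩ := (krullTopology_mem_nhds_one_iff K M _).1 ht'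
  obtain ⟨θ, hθ⟩ := Field.exists_primitive_element K E
  have hint : IsIntegral K (θ : M) := Algebra.IsIntegral.isIntegral _
  classical
  have fin : (Set.range fun d : D => (d : M ≃ₐ[K] M) (θ : M)).Finite := by
    refine ((minpoly K (θ : M)).rootSet_finite M).subset ?_
    rintro _ ⟨d, rfl⟩
    rw [Polynomial.mem_rootSet]
    refine ⟨minpoly.ne_zero hint, ?_⟩
    change Polynomial.aeval ((d : M ≃ₐ[K] M).toAlgHom (θ : M)) _ = 0
    rw [Polynomial.aeval_algHom_apply, minpoly.aeval, map_zero]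
  let O := fin.toFinset
  have hO : ∀ y, y ∈ O ↔ ∃ d ∈ D, d (θ : M) = y := by
    intro y; simp [O]
  -- `D` permutes the roots of `P`, so its coefficients are fixed by `D`, hence by `σ`. Thus `σ`
  -- maps the root `θ` to another root, which is a point of the orbit `D θ`.
  let P : Polynomial M := ∏ y ∈ O, (Polynomial.X - Polynomial.C y)
  have hP : ∀ d ∈ D, P.map (d : M →+* M) = P := by
    intro d hd
    simp only [P, Polynomial.map_prod, Polynomial.map_sub, Polynomial.map_X, Polynomial.map_C]
    refine Finset.prod_bij (fun y _ => d y) ?_ (fun _ _ _ _ h => d.injective h) ?_ ?_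
    · intro y hy
      obtain ⟨e, he, rfl⟩ := (hO y).1 hy
      exact (hO _).2 ⟨d * e, D.mul_mem hd he, rfl⟩
    · intro y hy
      obtain ⟨e, he, rfl⟩ := (hO y).1 hy
      exact ⟨d.symm (e θ), (hO _).2 ⟨d⁻¹ * e, D.mul_mem (D.inv_mem hd) he, rfl⟩,
        d.apply_symm_apply _⟩
    · intro y _; rfl
  have hσP : P.map (σ : M →+* M) = P := by
    ext n
    rw [Polynomial.coeff_map]
    refine h _ fun d hd => ?_
    have := congrArg (fun p => Polynomial.coeff p n) (hP d hd)
    simpa [Polynomial.coeff_map] using this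
  have h0 : P.eval (θ : M) = 0 := by
    rw [Polynomial.eval_prod]
    exact Finset.prod_eq_zero ((hO _).2 ⟨1, D.one_mem, rfl⟩) (by simp)
  have h1 : P.eval (σ (θ : M)) = 0 := by
    rw [← hσP]
    change (P.map (σ : M →+* M)).eval ((σ : M →+* M) θ) = 0
    rw [Polynomial.eval_map_apply, h0, map_zero]
  obtain ⟨d, hd, hdθ⟩ : ∃ d ∈ D, d (θ : M) = σ θ := by
    rw [Polynomial.eval_prod, Finset.prod_eq_zero_iff] at h1
    obtain ⟨y, hy, e⟩ := h1
    rw [Polynomial.eval_sub, Polynomial.eval_X, Polynomial.eval_C, sub_eq_zero] at e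
    rw [e]
    exact (hO y).1 hy
  refine ⟨d, ?_, hd⟩
  have : σ⁻¹ * d ∈ (fun τ => σ * τ) ⁻¹' t := by
    refine hE ?_
    rw [SetLike.mem_coe, IntermediateField.mem_fixingSubgroup_iff]
    intro x hx
    have key : ∀ y : E, y ∈ IntermediateField.adjoin K {θ} → (σ⁻¹ * d) (y : M) = y := by
      intro y hy
      induction hy using IntermediateField.adjoin_induction with
      | mem y hy =>
        rw [Set.mem_singleton_iff.1 hy, AlgEquiv.mul_apply, hdθ]
        exact σ.symm_apply_apply _
      | algebraMap y => exact (σ⁻¹ * d).commutes y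
      | add y z _ _ hy hz => rw [IntermediateField.coe_add, map_add, hy, hz]
      | inv y _ hy => rw [IntermediateField.coe_inv, map_inv₀, hy]
      | mul y z _ _ hy hz => rw [IntermediateField.coe_mul, map_mul, hy, hz]
    exact key ⟨x, hx⟩ (hθ ▸ IntermediateField.mem_top)
  simpa using this

end Trace

/-! ## The groupoid of conjugate fields -/

namespace ConjField

variable {K : Type u} {N : Type v} [Field K] [Field N] [Algebra K N] {L : IntermediateField K N}

/-- The field `L` as one of its conjugates. -/
def base (L : IntermediateField K N) : ConjField L := ⟨L, AlgEquiv.refl, L.map_id⟩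

theorem nonempty_base_hom (E : ConjField L) : Nonempty (base L ⟶ E) := by
  obtain ⟨F, g, rfl⟩ := E
  exact ⟨⟨IntermediateField.intermediateFieldMap g L, g, fun _ => rfl⟩⟩

theorem nonempty_hom (E F : ConjField L) : Nonempty (E ⟶ F) := by
  obtain ⟨σ⟩ := nonempty_base_hom E
  obtain ⟨τ⟩ := nonempty_base_hom F
  exact ⟨Groupoid.inv σ ≫ τ⟩

theorem isSeparable_field [Algebra.IsSeparable K L] (E : ConjField L) :
    Algebra.IsSeparable K E.field := by
  obtain ⟨σ⟩ := nonempty_base_hom E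
  have : Algebra.IsSeparable K (base L).field := ‹Algebra.IsSeparable K L›
  exact AlgEquiv.Algebra.isSeparable (toEquiv σ)

/-- The action of the isotropy group of `E` on the field `E`. Since the multiplication of the
isotropy group is composition in diagrammatic order, `γ` acts by the inverse of `γ`. -/
@[reducible]
def mulSemiringAction (E : ConjField L) : MulSemiringAction (E ⟶ E) E.field where
  smul γ x := toEquiv (Groupoid.inv γ) x
  one_smul _ := rfl
  mul_smul _ _ _ := rfl
  smul_zero _ := map_zero _
  smul_add _ _ _ := map_add _ _ _
  smul_one _ := map_one _
  smul_mul _ _ _ := map_mul _ _ _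

/-- A subgroup of the isotropy group as a group of automorphisms of the field. -/
def autSubgroup {E : ConjField L} (H : Subgroup (E ⟶ E)) : Subgroup (E.field ≃ₐ[K] E.field) where
  carrier := toEquiv '' (H : Set (E ⟶ E))
  one_mem' := ⟨1, H.one_mem, rfl⟩
  mul_mem' := by
    rintro _ _ ⟨σ, hσ, rfl⟩ ⟨τ, hτ, rfl⟩
    -- The order is reversed because isotropy groups multiply in diagrammatic order.
    exact ⟨τ * σ, H.mul_mem hτ hσ, rfl⟩
  inv_mem' := by
    rintro _ ⟨σ, hσ, rfl⟩
    exact ⟨σ⁻¹, H.inv_mem hσ, rfl⟩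

/-- A subgroup of the isotropy group which is closed in the Krull topology consists of all
morphisms which fix the elements fixed by the subgroup. -/
theorem mem_of_fixes_fixed [Algebra.IsSeparable K L] {E : ConjField L} (H : Subgroup (E ⟶ E))
    (hH : IsClosed[E.krull] (H : Set (E ⟶ E))) (σ : E ⟶ E)
    (h : ∀ x : E.field, (∀ τ ∈ H, toEquiv τ x = x) → toEquiv σ x = x) : σ ∈ H := by
  have := isSeparable_field E
  obtain ⟨t, ht, e⟩ := isClosed_induced_iff.1 hH
  -- `t` is a closed set of automorphisms with preimage `H`. It contains the image of `H`, hence the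
  -- closure of that image.
  have hle : (autSubgroup H : Set (E.field ≃ₐ[K] E.field)) ⊆ t := by
    rintro _ ⟨τ, hτ, rfl⟩
    exact e.ge hτ
  refine e.le (ht.closure_subset_iff.2 hle (mem_closure_of_fixes_fixed _ _ fun x hx => ?_))
  exact h x fun τ hτ => hx _ ⟨τ, hτ, rfl⟩

/-- Closedness supplies the hypothesis of `exists_fixed_sum_out_smul_eq_one`. The inverses in the
sum come from the action, which turns diagrammatic multiplication into a left action. -/
theorem exists_fixed_sum_eq_one [Algebra.IsSeparable K L] {E : ConjField L} (H : Subgroup (E ⟶ E))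
    [Fintype ((E ⟶ E) ⧸ H)] (hH : IsClosed[E.krull] (H : Set (E ⟶ E))) :
    ∃ x : E.field, (∀ τ ∈ H, toEquiv τ x = x) ∧
      ∑ q : (E ⟶ E) ⧸ H, toEquiv (Groupoid.inv q.out) x = 1 := by
  let := mulSemiringAction E
  have inv_inv : ∀ τ : E ⟶ E, Groupoid.inv (Groupoid.inv τ) = τ := fun τ => inv_inv τ
  obtain ⟨x, hx, h⟩ := exists_fixed_sum_out_smul_eq_one (M := E.field) H fun g hg => by
    refine H.inv_mem_iff.1 (mem_of_fixes_fixed H hH _ fun x hx => hg x ?_)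
    rintro ⟨τ, hτ⟩
    exact hx _ (H.inv_mem hτ)
  refine ⟨x, fun τ hτ => ?_, h⟩
  have := hx ⟨τ⁻¹, H.inv_mem hτ⟩
  rw [← inv_inv τ]
  exact this

end ConjField

/-! ## The relative tensor product -/

namespace SepExt

variable {R : Type w} [NonUnitalRing R] {S : NonUnitalSubring R}

variable (S) in
/-- The element `r ⊗ r'` of `R ⊗_S R`. -/
def tmul (r r' : R) : RelTensor S := QuotientAddGroup.mk (r ⊗ₜ[ℤ] r')

theorem tmul_mul_left (r r' : R) {s : R} (hs : s ∈ S) :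
    tmul S (r * s) r' = tmul S r (s * r') := by
  rw [← sub_eq_zero]
  exact (QuotientAddGroup.eq_zero_iff _).2 (AddSubgroup.subset_closure ⟨r, r', s, hs, rfl⟩)

@[simp] theorem leftAct_tmul (x r r' : R) : leftAct S x (tmul S r r') = tmul S (x * r) r' := rfl

@[simp] theorem rightAct_tmul (x r r' : R) : rightAct S x (tmul S r r') = tmul S r (r' * x) := rfl

@[simp] theorem mulMap_tmul (r r' : R) : mulMap S (tmul S r r') = r * r' := rfl

theorem add_tmul (r s r' : R) : tmul S (r + s) r' = tmul S r r' + tmul S s r' := by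
  rw [tmul, TensorProduct.add_tmul]; rfl

theorem tmul_add (r r' s' : R) : tmul S r (r' + s') = tmul S r r' + tmul S r s' := by
  rw [tmul, TensorProduct.tmul_add]; rfl

theorem zero_tmul (r' : R) : tmul S 0 r' = 0 := by
  rw [tmul, TensorProduct.zero_tmul]; rfl

theorem tmul_zero (r : R) : tmul S r 0 = 0 := by
  rw [tmul, TensorProduct.tmul_zero]; rfl

@[elab_as_elim]
theorem relTensor_induction {P : RelTensor S → Prop} (t : RelTensor S) (zero : P 0)
    (tmul : ∀ r r', P (tmul S r r')) (add : ∀ x y, P x → P y → P (x + y)) : P t := by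
  obtain ⟨t, rfl⟩ := QuotientAddGroup.mk_surjective t
  induction t using TensorProduct.induction_on with
  | zero => exact zero
  | tmul r r' => exact tmul r r'
  | add x y hx hy => exact add _ _ hx hy

theorem relTensor_hom_ext {M : Type*} [AddCommMonoid M] {f g : RelTensor S →+ M}
    (h : ∀ r r', f (tmul S r r') = g (tmul S r r')) : f = g := by
  refine AddMonoidHom.ext fun t => ?_
  induction t using relTensor_induction with
  | zero => rw [map_zero, map_zero]
  | tmul r r' => exact h r r'
  | add x y hx hy => rw [map_add, map_add, hx, hy]

theorem leftAct_mul (x y : R) (t : RelTensor S) :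
    leftAct S (x * y) t = leftAct S x (leftAct S y t) := by
  refine DFunLike.congr_fun (f := leftAct S (x * y)) (g := (leftAct S x).comp (leftAct S y))
    (relTensor_hom_ext fun r r' => ?_) t
  simp [mul_assoc]

theorem rightAct_mul (x y : R) (t : RelTensor S) :
    rightAct S (x * y) t = rightAct S y (rightAct S x t) := by
  refine DFunLike.congr_fun (f := rightAct S (x * y)) (g := (rightAct S y).comp (rightAct S x))
    (relTensor_hom_ext fun r r' => ?_) t
  simp [mul_assoc]

theorem leftAct_add (x y : R) (t : RelTensor S) :
    leftAct S (x + y) t = leftAct S x t + leftAct S y t := by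
  refine DFunLike.congr_fun (f := leftAct S (x + y)) (g := leftAct S x + leftAct S y)
    (relTensor_hom_ext fun r r' => ?_) t
  simp [add_mul, add_tmul]

theorem leftAct_zero (t : RelTensor S) : leftAct S 0 t = 0 := by
  refine DFunLike.congr_fun (f := leftAct S 0) (g := 0) (relTensor_hom_ext fun r r' => ?_) t
  simp [zero_tmul]

theorem leftAct_rightAct (x y : R) (t : RelTensor S) :
    leftAct S x (rightAct S y t) = rightAct S y (leftAct S x t) := by
  refine DFunLike.congr_fun (f := (leftAct S x).comp (rightAct S y))
    (g := (rightAct S y).comp (leftAct S x)) (relTensor_hom_ext fun r r' => ?_) t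
  simp

theorem rightAct_add (x y : R) (t : RelTensor S) :
    rightAct S (x + y) t = rightAct S x t + rightAct S y t := by
  refine DFunLike.congr_fun (f := rightAct S (x + y)) (g := rightAct S x + rightAct S y)
    (relTensor_hom_ext fun r r' => ?_) t
  simp [mul_add, tmul_add]

theorem rightAct_zero (t : RelTensor S) : rightAct S 0 t = 0 := by
  refine DFunLike.congr_fun (f := rightAct S 0) (g := 0) (relTensor_hom_ext fun r r' => ?_) t
  simp [tmul_zero]

theorem mulMap_leftAct (x : R) (t : RelTensor S) :
    mulMap S (leftAct S x t) = x * mulMap S t := by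
  refine DFunLike.congr_fun (f := (mulMap S).comp (leftAct S x))
    (g := (AddMonoidHom.mulLeft x).comp (mulMap S)) (relTensor_hom_ext fun r r' => ?_) t
  simp [mul_assoc]

end SepExt

/-! ## Homogeneous elements of object crossed products -/

namespace ObjectCrossedSystem

variable {C : Type u} [Groupoid.{v} C] {A : C → Type w} [∀ e, Ring (A e)]
  (S : ObjectCrossedSystem C A)

/-- The element `a u_e` for an identity morphism `e`. -/
def scalar (e : C) (a : A e) : S.CrossedProduct := S.single ⟨e, e, 𝟙 e⟩ a

theorem scalar_mul_single {e f : C} (τ : e ⟶ f) (a b : A f) :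
    S.scalar f a * S.single ⟨e, f, τ⟩ b = S.single ⟨e, f, τ⟩ (a * b) := by
  rw [scalar, single_mul_single, α_id, β_id_left, Category.comp_id, Units.val_one, mul_one]

theorem single_mul_scalar {e f : C} (τ : e ⟶ f) (a : A f) (b : A e) :
    S.single ⟨e, f, τ⟩ a * S.scalar e b = S.single ⟨e, f, τ⟩ (a * S.α τ b) := by
  rw [scalar, single_mul_single, β_id_right, Category.id_comp, Units.val_one, mul_one]

theorem scalar_mul_scalar (e : C) (a b : A e) :
    S.scalar e a * S.scalar e b = S.scalar e (a * b) := S.scalar_mul_single _ a b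

variable {S} in
theorem scalar_one_mul {e f : C} (τ : e ⟶ f) (a : A f) :
    S.scalar f 1 * S.single ⟨e, f, τ⟩ a = S.single ⟨e, f, τ⟩ a := by
  rw [scalar_mul_single, one_mul]

variable {S} in
theorem mul_scalar_one {e f : C} (τ : e ⟶ f) (a : A f) :
    S.single ⟨e, f, τ⟩ a * S.scalar e 1 = S.single ⟨e, f, τ⟩ a := by
  rw [single_mul_scalar, map_one, mul_one]

theorem coeff_single_self (p : Mor C) (a : A p.ran) : S.coeff p (S.single p a) = a := by
  rw [coeff_single, dif_pos rfl]

theorem coeff_single_of_ne {p q : Mor C} (h : p ≠ q) (a : A p.ran) :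
    S.coeff q (S.single p a) = 0 := by
  rw [coeff_single, dif_neg h]

theorem single_mem_subring {Δ : Subgroupoid C} {p : Mor C} (hp : p.hom ∈ Δ.arrows p.dom p.ran)
    (a : A p.ran) : S.single p a ∈ S.subring Δ := by
  intro q hq
  by_cases h : p = q
  · exact h ▸ hp
  · exact absurd (S.coeff_single_of_ne h a) hq

/-- The coefficient at the identity of the object `e`. -/
abbrev coeffId (e : C) : S.CrossedProduct →+ A e := S.coeff ⟨e, e, 𝟙 e⟩

theorem coeffId_scalar_mul (e : C) (b : A e) (y : S.CrossedProduct) :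
    S.coeffId e (S.scalar e b * y) = b * S.coeffId e y := by
  induction y using induction with
  | h0 => simp
  | h2 x y hx hy => rw [mul_add, map_add, map_add, hx, hy, mul_add]
  | h1 q c =>
    obtain ⟨d, g, ρ⟩ := q
    by_cases hg : g = e
    · subst hg
      rw [scalar_mul_single]
      by_cases h : (⟨d, g, ρ⟩ : Mor C) = ⟨g, g, 𝟙 g⟩
      · obtain ⟨rfl, h⟩ : d = g ∧ HEq ρ (𝟙 g) := by simpa using h
        obtain rfl := eq_of_heq h
        rw [coeff_single_self, coeff_single_self]
      · rw [coeff_single_of_ne S h, coeff_single_of_ne S h, mul_zero]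
    · rw [scalar, single_mul_single_of_ne S _ _ hg, coeff_single_of_ne, map_zero, mul_zero]
      exact fun h => hg (by simpa using congrArg Mor.ran h)

theorem coeffId_single_mul_of_ne {e : C} {p : Mor C} (hp : p.ran ≠ e) (a : A p.ran)
    (y : S.CrossedProduct) : S.coeffId e (S.single p a * y) = 0 := by
  induction y using induction with
  | h0 => simp
  | h2 x y hx hy => rw [mul_add, map_add, hx, hy, add_zero]
  | h1 q c =>
    obtain ⟨d, g, ρ⟩ := q
    obtain ⟨f, e', τ⟩ := p
    by_cases hg : g = f
    · subst hg
      rw [single_mul_single, coeff_single_of_ne]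
      exact fun h => hp (by simpa using congrArg Mor.ran h)
    · rw [single_mul_single_of_ne S _ _ hg, map_zero]

/-- `σρσ⁻¹` is an identity only if `ρ` is, so only the identity component of `y` contributes. -/
theorem coeffId_conj {e : C} (σ : e ⟶ e) (y : S.CrossedProduct) :
    S.coeffId e (S.single ⟨e, e, σ⟩ 1 * y * S.single ⟨e, e, Groupoid.inv σ⟩ 1) =
      S.α σ (S.coeffId e y) * S.β σ (Groupoid.inv σ) := by
  induction y using induction with
  | h0 => simp
  | h2 x y hx hy => rw [mul_add, add_mul, map_add, map_add, map_add, hx, hy, add_mul]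
  | h1 q c =>
    obtain ⟨d, g, ρ⟩ := q
    by_cases hg : g = e
    · subst hg
      rw [single_mul_single]
      by_cases hd : d = g
      · subst hd
        rw [single_mul_single]
        by_cases hρ : ρ = 𝟙 d
        · subst hρ
          have : (⟨d, d, Groupoid.inv σ ≫ 𝟙 d ≫ σ⟩ : Mor C) = ⟨d, d, 𝟙 d⟩ := by simp
          rw [coeff_single_self]
          have key : ∀ {ρ : d ⟶ d} (_ : ρ = 𝟙 d) (z : A d),
              S.coeffId d (S.single ⟨d, d, ρ⟩ z) = z := by
            rintro _ rfl z
            exact S.coeff_single_self _ _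
          rw [key (by simp), β_id_right]
          simp
        · rw [coeff_single_of_ne, coeff_single_of_ne, map_zero, zero_mul]
          · exact fun h => hρ (by simpa using h)
          · intro h
            have h : Groupoid.inv σ ≫ ρ ≫ σ = 𝟙 d := by simpa using h
            apply hρ
            have := congrArg (fun x => σ ≫ x ≫ Groupoid.inv σ) h
            simpa using this
      · rw [single_mul_single_of_ne, map_zero, coeff_single_of_ne, map_zero, zero_mul]
        · exact fun h => hd (by simpa using congrArg Mor.dom h)
        · exact fun h => hd h.symm
    · rw [single_mul_single_of_ne S _ _ hg, zero_mul, map_zero, coeff_single_of_ne, map_zero,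
        zero_mul]
      exact fun h => hg (by simpa using congrArg Mor.ran h)

/-! ## Separability implies finite index -/

/-- The coset `pΔ`: all morphisms `pδ` with `δ` in `Δ`. -/
def coset (Δ : Subgroupoid C) (p : Mor C) : Set (Mor C) :=
  {m | ∃ (d : C) (δ : d ⟶ p.dom), δ ∈ Δ.arrows d p.dom ∧ m = ⟨d, p.ran, δ ≫ p.hom⟩}

theorem coset_comp {Δ : Subgroupoid C} {d f e : C} {δ : d ⟶ f} (hδ : δ ∈ Δ.arrows d f)
    (τ : f ⟶ e) : coset Δ ⟨d, e, δ ≫ τ⟩ = coset Δ ⟨f, e, τ⟩ := by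
  ext m
  constructor
  · rintro ⟨c, γ, hγ, rfl⟩
    exact ⟨c, γ ≫ δ, Δ.mul hγ hδ, by simp⟩
  · rintro ⟨c, γ, hγ, rfl⟩
    exact ⟨c, γ ≫ Groupoid.inv δ, Δ.mul hγ (Δ.inv hδ), by simp⟩

/-- Translation of a set of morphisms with range `e` by an element of the isotropy group. -/
def translate {e : C} (σ : e ⟶ e) (P : Set (Mor C)) : Set (Mor C) :=
  {m | ∃ (d : C) (τ : d ⟶ e), (⟨d, e, τ⟩ : Mor C) ∈ P ∧ m = ⟨d, e, τ ≫ σ⟩}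

theorem translate_coset (Δ : Subgroupoid C) {e f : C} (σ : e ⟶ e) (τ : f ⟶ e) :
    translate σ (coset Δ ⟨f, e, τ⟩) = coset Δ ⟨f, e, τ ≫ σ⟩ := by
  ext m
  constructor
  · rintro ⟨d, ρ, ⟨c, γ, hγ, h⟩, rfl⟩
    obtain ⟨rfl, h⟩ : d = c ∧ HEq ρ (γ ≫ τ) := by simpa using h
    obtain rfl := eq_of_heq h
    exact ⟨d, γ, hγ, by simp⟩
  · rintro ⟨c, γ, hγ, rfl⟩
    exact ⟨c, γ ≫ τ, ⟨c, γ, hγ, rfl⟩, by simp⟩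

/-- The map `r ⊗ r' ↦ ∑ [pΔ] c_p`, where `c_p` is the coefficient at the identity of `e` of the
product of the component of `r` at `p` with `r'`. -/
def preCosetCoeff (Δ : Subgroupoid C) (e : C) :
    S.CrossedProduct →+ S.CrossedProduct →+ (Set (Mor C) →₀ A e) := by
  classical
  exact DirectSum.toAddMonoid (β := fun p : Mor C => A p.ran) fun p =>
    AddMonoidHom.mk' (fun a => ((Finsupp.singleAddHom (coset Δ p)).comp (S.coeffId e)).comp
      (AddMonoidHom.mulLeft (S.single p a))) (fun a b => by ext1 r; simp [add_mul])

theorem preCosetCoeff_single (Δ : Subgroupoid C) (e : C) (p : Mor C) (a : A p.ran)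
    (r : S.CrossedProduct) : S.preCosetCoeff Δ e (S.single p a) r =
      Finsupp.single (coset Δ p) (S.coeffId e (S.single p a * r)) := by
  classical
  exact DFunLike.congr_fun (DirectSum.toAddMonoid_of (β := fun p : Mor C => A p.ran) _ p a) r

/-- Moving a homogeneous `s` of degree `δ ∈ Δ` across the tensor sign changes neither the total
product nor the coset, as `pδΔ = pΔ`. This is what lets the map descend to `R ⊗_S R`. -/
theorem preCosetCoeff_mul (Δ : Subgroupoid C) (e : C) (r r' : S.CrossedProduct)
    {s : S.CrossedProduct} (hs : s ∈ S.subring Δ) :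
    S.preCosetCoeff Δ e (r * s) r' = S.preCosetCoeff Δ e r (s * r') := by
  let T : AddSubgroup S.CrossedProduct :=
    (AddMonoidHom.eqLocus ((S.preCosetCoeff Δ e).flip r' |>.comp (AddMonoidHom.mulLeft r))
      ((S.preCosetCoeff Δ e r).comp (AddMonoidHom.mulRight r')))
  refine S.mem_of_single_mem (D := {p | p.hom ∈ Δ.arrows p.dom p.ran}) (T := T)
    (fun q hq b => ?_) s hs
  change S.preCosetCoeff Δ e (r * S.single q b) r' = S.preCosetCoeff Δ e r (S.single q b * r')
  induction r using induction with
  | h0 => simp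
  | h2 x y hx hy =>
    rw [add_mul, map_add, map_add, AddMonoidHom.add_apply, AddMonoidHom.add_apply, hx, hy]
  | h1 p a =>
    obtain ⟨f, g, τ⟩ := p
    obtain ⟨d, f', δ⟩ := q
    rw [preCosetCoeff_single, ← mul_assoc]
    by_cases h : f' = f
    · subst h
      rw [single_mul_single, preCosetCoeff_single, coset_comp hq]
    · rw [single_mul_single_of_ne S _ _ h]
      simp

/-- The map `preCosetCoeff` on the relative tensor product. -/
def cosetCoeff (Δ : Subgroupoid C) (e : C) :
    SepExt.RelTensor (S.subring Δ) →+ (Set (Mor C) →₀ A e) :=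
  QuotientAddGroup.lift _ (TensorProduct.liftAddHom (S.preCosetCoeff Δ e) (fun n r r' => by simp))
    (by
      refine (AddSubgroup.closure_le _).2 ?_
      rintro _ ⟨r, r', s, hs, rfl⟩
      simp [AddMonoidHom.mem_ker, S.preCosetCoeff_mul Δ e r r' hs])

theorem cosetCoeff_tmul_single (Δ : Subgroupoid C) (e : C) (p : Mor C) (a : A p.ran)
    (r : S.CrossedProduct) : S.cosetCoeff Δ e (SepExt.tmul _ (S.single p a) r) =
      Finsupp.single (coset Δ p) (S.coeffId e (S.single p a * r)) :=
  S.preCosetCoeff_single Δ e p a r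

variable {S} in
theorem relTensor_hom_ext_single {Δ : Subgroupoid C} {M : Type*} [AddCommMonoid M]
    {f g : SepExt.RelTensor (S.subring Δ) →+ M}
    (h : ∀ p a r, f (SepExt.tmul _ (S.single p a) r) = g (SepExt.tmul _ (S.single p a) r)) :
    f = g := by
  refine SepExt.relTensor_hom_ext fun r r' => ?_
  induction r using induction with
  | h0 => rw [SepExt.zero_tmul, map_zero, map_zero]
  | h2 x y hx hy => rw [SepExt.add_tmul, map_add, map_add, hx, hy]
  | h1 p a => exact h p a r'

/-- Summing over cosets forgets the grading; for a section this forces the coset function of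
`δ(1_e)` to be nonzero. -/
theorem sum_cosetCoeff (Δ : Subgroupoid C) (e : C) (t : SepExt.RelTensor (S.subring Δ)) :
    (S.cosetCoeff Δ e t).sum (fun _ a => a) = S.coeffId e (SepExt.mulMap _ t) := by
  refine DFunLike.congr_fun (f := (Finsupp.liftAddHom fun _ => AddMonoidHom.id (A e)).comp
    (S.cosetCoeff Δ e)) (g := (S.coeffId e).comp (SepExt.mulMap _))
    (relTensor_hom_ext_single fun p a r => ?_) t
  simp [cosetCoeff_tmul_single]

theorem cosetCoeff_scalar (Δ : Subgroupoid C) (e : C) (b : A e)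
    (t : SepExt.RelTensor (S.subring Δ)) :
    S.cosetCoeff Δ e (SepExt.leftAct _ (S.scalar e b) t) =
      Finsupp.mapRange.addMonoidHom (AddMonoidHom.mulLeft b) (S.cosetCoeff Δ e t) := by
  refine DFunLike.congr_fun (f := (S.cosetCoeff Δ e).comp (SepExt.leftAct _ (S.scalar e b)))
    (g := (Finsupp.mapRange.addMonoidHom (AddMonoidHom.mulLeft b)).comp (S.cosetCoeff Δ e))
    (relTensor_hom_ext_single fun p a r => ?_) t
  obtain ⟨f, g, τ⟩ := p
  simp only [AddMonoidHom.comp_apply, SepExt.leftAct_tmul, cosetCoeff_tmul_single,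
    Finsupp.mapRange.addMonoidHom_apply, Finsupp.mapRange_single, AddMonoidHom.coe_mulLeft]
  rw [← coeffId_scalar_mul, ← mul_assoc]
  by_cases h : g = e
  · subst h
    rw [scalar_mul_single, cosetCoeff_tmul_single]
  · rw [scalar, single_mul_single_of_ne S _ _ h]
    simp [SepExt.zero_tmul]

theorem cosetCoeff_conj (Δ : Subgroupoid C) {e : C} (σ : e ⟶ e)
    (t : SepExt.RelTensor (S.subring Δ)) :
    S.cosetCoeff Δ e (SepExt.leftAct _ (S.single ⟨e, e, σ⟩ 1)
      (SepExt.rightAct _ (S.single ⟨e, e, Groupoid.inv σ⟩ 1) t)) =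
      Finsupp.mapDomain (translate σ) (Finsupp.mapRange.addMonoidHom
        ((AddMonoidHom.mulRight (S.β σ (Groupoid.inv σ) : A e)).comp (S.α σ).toAddMonoidHom)
        (S.cosetCoeff Δ e t)) := by
  refine DFunLike.congr_fun (f := (S.cosetCoeff Δ e).comp ((SepExt.leftAct _
    (S.single ⟨e, e, σ⟩ 1)).comp (SepExt.rightAct _ (S.single ⟨e, e, Groupoid.inv σ⟩ 1))))
    (g := (Finsupp.mapDomain.addMonoidHom (translate σ)).comp
      ((Finsupp.mapRange.addMonoidHom ((AddMonoidHom.mulRight (S.β σ (Groupoid.inv σ) : A e)).comp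
        (S.α σ).toAddMonoidHom)).comp (S.cosetCoeff Δ e)))
    (relTensor_hom_ext_single fun p a r => ?_) t
  obtain ⟨f, g, τ⟩ := p
  have key : S.α σ (S.coeffId e (S.single ⟨f, g, τ⟩ a * r)) * S.β σ (Groupoid.inv σ) =
      S.coeffId e (S.single ⟨e, e, σ⟩ 1 * S.single ⟨f, g, τ⟩ a *
        (r * S.single ⟨e, e, Groupoid.inv σ⟩ 1)) := by
    rw [← coeffId_conj]
    simp only [mul_assoc]
  simp only [AddMonoidHom.comp_apply, SepExt.leftAct_tmul, SepExt.rightAct_tmul,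
    cosetCoeff_tmul_single, Finsupp.mapRange.addMonoidHom_apply, Finsupp.mapRange_single,
    Finsupp.mapDomain.addMonoidHom_apply, Finsupp.mapDomain_single, AddMonoidHom.coe_mulRight]
  refine Eq.trans ?_ (congrArg _ key.symm)
  by_cases h : g = e
  · subst h
    rw [single_mul_single, cosetCoeff_tmul_single, translate_coset]
  · rw [single_mul_single_of_ne S _ _ h]
    simp [SepExt.zero_tmul]

/-- A left factor whose range is not `e` cannot produce a coefficient at the identity of `e`. So
every coset in the support can be translated by the isotropy group of `e`. -/
theorem exists_eq_coset_of_mem_support (Δ : Subgroupoid C) (e : C)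
    (t : SepExt.RelTensor (S.subring Δ)) (P : Set (Mor C))
    (hP : P ∈ (S.cosetCoeff Δ e t).support) :
    ∃ (f : C) (τ : f ⟶ e), P = coset Δ ⟨f, e, τ⟩ := by
  classical
  induction t using SepExt.relTensor_induction with
  | zero => simp at hP
  | add x y hx hy =>
    rw [map_add] at hP
    exact (Finset.mem_union.1 (Finsupp.support_add hP)).elim hx hy
  | tmul r r' =>
    induction r using induction with
    | h0 => simp [SepExt.zero_tmul] at hP
    | h2 x y hx hy =>
      rw [SepExt.add_tmul, map_add] at hP
      exact (Finset.mem_union.1 (Finsupp.support_add hP)).elim hx hy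
    | h1 p a =>
      rw [cosetCoeff_tmul_single] at hP
      obtain ⟨f, g, τ⟩ := p
      have hg : g = e := by
        by_contra h
        rw [coeffId_single_mul_of_ne S h] at hP
        simp at hP
      subst hg
      exact ⟨f, τ, Finset.mem_singleton.1 (Finsupp.support_single_subset hP)⟩

/-- If an object crossed product is separable over the subring given by a wide subgroupoid `Δ`, then
every object `e` with `A_e ≠ 0` is connected to an object at which the isotropy group of `Δ` has
finite index. -/
theorem exists_finiteIndex_of_isSeparableExt {Δ : Subgroupoid C} (hΔ : Δ.IsWide)
    (h : SepExt.IsSeparableExt (S.subring Δ)) (e : C) [Nontrivial (A e)] :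
    ∃ (f : C) (_ : f ⟶ e), (Δ.vertexSubgroup (Δ.mem_objs_of_src (hΔ.wide f))).FiniteIndex := by
  classical
  obtain ⟨δ, hl, hr, hm⟩ := h
  set x := δ (S.scalar e 1)
  set c := S.cosetCoeff Δ e x
  obtain ⟨P, hP⟩ : c.support.Nonempty := by
    rw [Finset.nonempty_iff_ne_empty]
    intro h0
    have h1 := S.sum_cosetCoeff Δ e x
    rw [hm, scalar, coeff_single_self] at h1
    refine one_ne_zero (α := A e) (h1.symm.trans ?_)
    rw [show S.cosetCoeff Δ e x = 0 from Finsupp.support_eq_empty.1 h0, Finsupp.sum_zero_index]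
  obtain ⟨f, τ, rfl⟩ := S.exists_eq_coset_of_mem_support Δ e x P hP
  -- Apply the bimodule map to `u_σ 1_e u_{σ⁻¹} = β_{σ,σ⁻¹} 1_e`.
  have conj : ∀ σ : e ⟶ e, SepExt.leftAct _ (S.single ⟨e, e, σ⟩ 1)
      (SepExt.rightAct _ (S.single ⟨e, e, Groupoid.inv σ⟩ 1) x) =
      SepExt.leftAct _ (S.scalar e (S.β σ (Groupoid.inv σ) : A e)) x := by
    intro σ
    rw [← hr, ← hl, ← hl, scalar_one_mul, single_mul_single, scalar_mul_scalar, map_one, one_mul,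
      one_mul, mul_one, Groupoid.inv_comp]
    rfl
  have stable : ∀ σ : e ⟶ e, coset Δ ⟨f, e, τ ≫ σ⟩ ∈ c.support := by
    intro σ
    -- Multiplication by the unit `β` preserves the support, so `τΔ` is the translate by `σ⁻¹` of
    -- some `Q` in the support; then `στΔ = Q`.
    have h1 := S.cosetCoeff_conj Δ (Groupoid.inv σ) x
    rw [conj, cosetCoeff_scalar] at h1
    have h2 : coset Δ ⟨f, e, τ⟩ ∈ (Finsupp.mapRange.addMonoidHom (AddMonoidHom.mulLeft
        (S.β (Groupoid.inv σ) (Groupoid.inv (Groupoid.inv σ)) : A e)) c).support := by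
      rw [Finsupp.mem_support_iff] at hP ⊢
      simpa using hP
    rw [h1] at h2
    obtain ⟨Q, hQ, hQP⟩ := Finset.mem_image.1 (Finsupp.mapDomain_support h2)
    have hQ' : Q ∈ c.support := Finsupp.support_mapRange (hf := map_zero _) hQ
    obtain ⟨f', τ', rfl⟩ := S.exists_eq_coset_of_mem_support Δ e x Q hQ'
    rw [← translate_coset, ← hQP, translate_coset, translate_coset]
    simpa using hQ'
  refine ⟨f, τ, ?_⟩
  set H := Δ.vertexSubgroup (Δ.mem_objs_of_src (hΔ.wide f))
  have mem : ∀ γ : f ⟶ f, coset Δ ⟨f, e, Groupoid.inv γ ≫ τ⟩ ∈ c.support := by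
    intro γ
    -- Conjugation by `τ` carries the isotropy group of `f` to that of `e`. The inverse of `γ`
    -- converts the cosets `γH` of the diagrammatic product into cosets of the form `pΔ`.
    have := stable (Groupoid.inv τ ≫ Groupoid.inv γ ≫ τ)
    simpa using this
  have : Finite ((f ⟶ f) ⧸ H) := by
    refine Finite.of_injective (β := c.support) (fun q => ⟨_, mem q.out⟩) fun q r hqr => ?_
    have h1 : coset Δ ⟨f, e, Groupoid.inv q.out ≫ τ⟩ = coset Δ ⟨f, e, Groupoid.inv r.out ≫ τ⟩ :=
      congrArg Subtype.val hqr
    have h2 : (⟨f, e, Groupoid.inv q.out ≫ τ⟩ : Mor C) ∈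
        coset Δ ⟨f, e, Groupoid.inv r.out ≫ τ⟩ :=
      h1 ▸ ⟨f, 𝟙 f, hΔ.wide f, by simp⟩
    obtain ⟨d, γ, hγ, h3⟩ := h2
    obtain ⟨rfl, h3⟩ : f = d ∧ HEq (Groupoid.inv q.out ≫ τ) (γ ≫ Groupoid.inv r.out ≫ τ) := by
      simpa using h3
    have h4 : Groupoid.inv q.out = γ ≫ Groupoid.inv r.out := by
      simpa using congrArg (· ≫ Groupoid.inv τ) (eq_of_heq h3)
    rw [← QuotientGroup.out_eq' q, ← QuotientGroup.out_eq' r]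
    refine QuotientGroup.eq.2 ?_
    have h5 : q.out⁻¹ * r.out = γ := by
      change Groupoid.inv q.out ≫ r.out = γ
      rw [h4]; simp
    rw [h5]
    exact hγ
  exact Subgroup.finiteIndex_of_finite_quotient

end ObjectCrossedSystem

/-! ## Finite index implies separability -/

namespace ObjectCrossedSystem

open SepExt

variable {C : Type u} [Groupoid.{v} C] {A : C → Type w} [∀ e, Ring (A e)]
  (S : ObjectCrossedSystem C A)

/-- `y` and `y'` are homogeneous elements of degrees `τ` and `τ⁻¹` which are inverse to each
other. -/
structure IsInvPair {e f : C} (τ : e ⟶ f) (y y' : S.CrossedProduct) : Prop where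
  left : ∃ a, y = S.single ⟨e, f, τ⟩ a
  right : ∃ a, y' = S.single ⟨f, e, Groupoid.inv τ⟩ a
  mul_inv : y * y' = S.scalar f 1
  inv_mul : y' * y = S.scalar e 1

/-- The coefficient of `y'` is chosen to cancel `β_{τ,τ⁻¹}`, giving a right inverse. Then `y' y` is
a scalar `b` with `y b = y`, and comparing coefficients gives `b = 1`. Such pairs spare the later
arguments all cocycle computations. -/
theorem exists_isInvPair {e f : C} (τ : e ⟶ f) :
    ∃ y', S.IsInvPair τ (S.single ⟨e, f, τ⟩ 1) y' := by
  set y := S.single ⟨e, f, τ⟩ 1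
  obtain ⟨c, hc⟩ := (S.α τ).surjective ((S.β τ (Groupoid.inv τ))⁻¹ : (A f)ˣ)
  set y' := S.single ⟨f, e, Groupoid.inv τ⟩ c
  have h1 : y * y' = S.scalar f 1 := by
    simp only [y, y']
    rw [single_mul_single, hc, one_mul, Units.inv_mul, Groupoid.inv_comp]
    rfl
  have h2 : ∃ b, y' * y = S.scalar e b := by
    refine ⟨c * S.α (Groupoid.inv τ) 1 * S.β (Groupoid.inv τ) τ, ?_⟩
    simp only [y, y']
    rw [single_mul_single, Groupoid.comp_inv]
    rfl
  obtain ⟨b, h2⟩ := h2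
  have h3 : S.single ⟨e, f, τ⟩ (S.α τ b) = S.single ⟨e, f, τ⟩ 1 := by
    have h4 : y * S.scalar e b = y := by
      rw [← h2, ← mul_assoc, h1, scalar_one_mul]
    rwa [single_mul_scalar, one_mul] at h4
  have h5 : S.α τ b = 1 := by
    have := congrArg (S.coeff ⟨e, f, τ⟩) h3
    rwa [coeff_single_self, coeff_single_self] at this
  have h6 : b = 1 := (S.α τ).injective (h5.trans (map_one _).symm)
  exact ⟨y', ⟨_, rfl⟩, ⟨_, rfl⟩, h1, h6 ▸ h2⟩

namespace IsInvPair

variable {S} {e f g : C} {τ : e ⟶ f} {σ : f ⟶ g} {y y' z z' : S.CrossedProduct}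

theorem scalar_mul (h : S.IsInvPair τ y y') : S.scalar f 1 * y = y := by
  obtain ⟨a, rfl⟩ := h.left
  exact scalar_one_mul τ a

theorem mul_scalar (h : S.IsInvPair τ y y') : y * S.scalar e 1 = y := by
  obtain ⟨a, rfl⟩ := h.left
  exact mul_scalar_one τ a

theorem symm (h : S.IsInvPair τ y y') : S.IsInvPair (Groupoid.inv τ) y' y := by
  refine ⟨h.right, ?_, h.inv_mul, h.mul_inv⟩
  have : Groupoid.inv (Groupoid.inv τ) = τ := by simp
  rw [this]
  exact h.left

theorem comp (hz : S.IsInvPair σ z z') (hy : S.IsInvPair τ y y') :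
    S.IsInvPair (τ ≫ σ) (z * y) (y' * z') := by
  refine ⟨?_, ?_, ?_, ?_⟩
  · obtain ⟨a, rfl⟩ := hy.left
    obtain ⟨b, rfl⟩ := hz.left
    exact ⟨_, S.single_mul_single _ _ _ _⟩
  · obtain ⟨a, rfl⟩ := hy.right
    obtain ⟨b, rfl⟩ := hz.right
    have : Groupoid.inv (τ ≫ σ) = Groupoid.inv σ ≫ Groupoid.inv τ := by simp
    rw [this]
    exact ⟨_, S.single_mul_single _ _ _ _⟩
  · rw [mul_assoc, ← mul_assoc y, hy.mul_inv, hz.symm.scalar_mul, hz.mul_inv]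
  · rw [mul_assoc, ← mul_assoc z', hz.inv_mul, hy.scalar_mul, hy.inv_mul]

theorem of_eq {τ' : e ⟶ f} (h : S.IsInvPair τ y y') (e : τ = τ') : S.IsInvPair τ' y y' := e ▸ h

end IsInvPair

variable {S} {Δ : Subgroupoid C} {e f : C} {x : A f} {y y' z z' : S.CrossedProduct}

/-- Here `s = y' z` is homogeneous of degree `δ`, with inverse `s' = z' y` in the subring, and `z =
y s`, `z' = s' y'`. Moving `s'` to the left gives `y s x s' ⊗ y'`, and `s` commutes with `x` because
`δ` fixes `x`. Thus the tensor depends only on the class of `τ` modulo `Δ`; for `δ = 𝟙 f` it does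
not depend on the chosen inverse pair. -/
theorem tmul_eq_tmul_of_isInvPair (hx : ∀ a, x * a = a * x) {δ : f ⟶ f} (hδ : δ ∈ Δ.arrows f f)
    (hδx : S.α δ x = x) {τ : f ⟶ e} (hy : S.IsInvPair τ y y') (hz : S.IsInvPair (δ ≫ τ) z z') :
    tmul (S.subring Δ) (z * S.scalar f x) z' = tmul _ (y * S.scalar f x) y' := by
  have hs : S.IsInvPair δ (y' * z) (z' * y) := (hy.symm.comp hz).of_eq (by simp)
  have h1 : y * (y' * z) = z := by rw [← mul_assoc, hy.mul_inv, hz.scalar_mul]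
  have h2 : z' * y * y' = z' := by rw [mul_assoc, hy.mul_inv, hz.symm.mul_scalar]
  have h3 : z' * y ∈ S.subring Δ := by
    obtain ⟨a, h⟩ := hs.right
    exact h ▸ S.single_mem_subring (Δ.inv hδ) a
  have h4 : y' * z * S.scalar f x = S.scalar f x * (y' * z) := by
    obtain ⟨a, h⟩ := hs.left
    rw [h, single_mul_scalar, scalar_mul_single, hδx, hx]
  conv_lhs => rw [← h1, ← h2]
  rw [← tmul_mul_left _ _ h3, mul_assoc y, h4, mul_assoc y, mul_assoc (S.scalar f x), hs.mul_inv,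
    scalar_mul_scalar, mul_one]

/-- Conjugating `b` by `y` gives a scalar `c` at `f` with `b y = y c` and `c y' = y' b`. It commutes
with `x` and, `Δ` being wide, lies in the subring, so it passes through the tensor sign. -/
theorem leftAct_scalar_tmul (hΔ : Δ.IsWide) (hx : ∀ a, x * a = a * x) {τ : f ⟶ e}
    (hy : S.IsInvPair τ y y') (b : A e) :
    leftAct (S.subring Δ) (S.scalar e b) (tmul _ (y * S.scalar f x) y') =
      rightAct _ (S.scalar e b) (tmul _ (y * S.scalar f x) y') := by
  obtain ⟨c, hc⟩ : ∃ c, y' * S.scalar e b * y = S.scalar f c := by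
    obtain ⟨a, rfl⟩ := hy.left
    obtain ⟨a', rfl⟩ := hy.right
    rw [single_mul_scalar, single_mul_single, Groupoid.comp_inv]
    exact ⟨_, rfl⟩
  have h1 : y * S.scalar f c = S.scalar e b * y := by
    rw [← hc, ← mul_assoc, ← mul_assoc, hy.mul_inv, scalar_mul_scalar, one_mul]
  have h2 : S.scalar f c * y' = y' * S.scalar e b := by
    rw [← hc, mul_assoc, hy.mul_inv, mul_assoc, scalar_mul_scalar, mul_one]
  have h3 : S.scalar f c ∈ S.subring Δ := S.single_mem_subring (p := ⟨f, f, 𝟙 f⟩) (hΔ.wide f) c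
  rw [leftAct_tmul, rightAct_tmul, ← mul_assoc, ← h1, mul_assoc, scalar_mul_scalar, ← hx,
    ← scalar_mul_scalar, ← mul_assoc, tmul_mul_left _ _ h3, h2]

variable (Δ x) in
/-- The element `u_τ x ⊗ u_τ⁻¹` of the relative tensor product. -/
def conjTensor (τ : f ⟶ e) : RelTensor (S.subring Δ) :=
  tmul _ (S.single ⟨f, e, τ⟩ 1 * S.scalar f x) (S.exists_isInvPair τ).choose

theorem conjTensor_comp (hx : ∀ a, x * a = a * x) {δ : f ⟶ f} (hδ : δ ∈ Δ.arrows f f)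
    (hδx : S.α δ x = x) (τ : f ⟶ e) :
    conjTensor (S := S) Δ x (δ ≫ τ) = conjTensor Δ x τ :=
  tmul_eq_tmul_of_isInvPair hx hδ hδx (S.exists_isInvPair _).choose_spec
    (S.exists_isInvPair _).choose_spec

/-- For `b = 1`, the product `u_σ u_τ` with its inverse is an admissible pair for `στ`, and `u_τ⁻¹ =
(u_σ u_τ)⁻¹ u_σ`. The scalar `b` is handled by `leftAct_scalar_tmul`. -/
theorem leftAct_conjTensor (hΔ : Δ.IsWide) (hx : ∀ a, x * a = a * x) (τ : f ⟶ e) {g : C}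
    (σ : e ⟶ g) (b : A g) :
    leftAct _ (S.single ⟨e, g, σ⟩ b) (conjTensor (S := S) Δ x τ) =
      rightAct _ (S.single ⟨e, g, σ⟩ b) (conjTensor Δ x (τ ≫ σ)) := by
  obtain ⟨w, hw⟩ := S.exists_isInvPair σ
  have hτ := (S.exists_isInvPair τ).choose_spec
  have h := tmul_eq_tmul_of_isInvPair hx (hΔ.wide f) (S.α_id f x) (hw.comp hτ)
    ((S.exists_isInvPair (τ ≫ σ)).choose_spec.of_eq (Category.id_comp _).symm)
  have h1 : leftAct _ (S.single ⟨e, g, σ⟩ 1) (conjTensor (S := S) Δ x τ) =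
      rightAct _ (S.single ⟨e, g, σ⟩ 1) (conjTensor Δ x (τ ≫ σ)) := by
    rw [conjTensor, conjTensor, h, leftAct_tmul, rightAct_tmul, mul_assoc _ w, hw.inv_mul,
      hτ.symm.mul_scalar, mul_assoc]
  have h2 : S.single ⟨e, g, σ⟩ b = S.scalar g b * S.single ⟨e, g, σ⟩ 1 := by
    rw [scalar_mul_single, mul_one]
  rw [h2, leftAct_mul, h1, leftAct_rightAct, rightAct_mul, conjTensor,
    leftAct_scalar_tmul hΔ hx (S.exists_isInvPair _).choose_spec]

theorem rightAct_conjTensor_of_ne (τ : f ⟶ e) {p : Mor C} (hp : p.ran ≠ e) (b : A p.ran) :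
    rightAct _ (S.single p b) (conjTensor (S := S) Δ x τ) = 0 := by
  obtain ⟨a, ha⟩ := (S.exists_isInvPair τ).choose_spec.right
  rw [conjTensor, rightAct_tmul, ha, single_mul_single_of_ne S _ _ hp, SepExt.tmul_zero]

theorem mulMap_conjTensor (τ : f ⟶ e) :
    mulMap _ (conjTensor (S := S) Δ x τ) = S.scalar e (S.α τ x) := by
  have : S.single ⟨f, e, τ⟩ 1 * S.scalar f x = S.scalar e (S.α τ x) * S.single ⟨f, e, τ⟩ 1 := by
    rw [single_mul_scalar, scalar_mul_single, one_mul, mul_one]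
  rw [conjTensor, mulMap_tmul, this, mul_assoc, (S.exists_isInvPair τ).choose_spec.mul_inv,
    scalar_mul_scalar, mul_one]

/-- Suppose that all objects are connected to `f`, and that `x` is a central element of `A_f` which
is fixed by the isotropy group of `Δ` at `f` and has trace one along the cosets of this group in the
whole isotropy group. Then the object crossed product is separable over the subring given by
`Δ`. -/
theorem isSeparableExt_of_sum_eq_one (hΔ : Δ.IsWide) (g : ∀ e, f ⟶ e)
    (H : Subgroup (f ⟶ f)) (hH : ∀ δ ∈ H, δ ∈ Δ.arrows f f) [Fintype ((f ⟶ f) ⧸ H)]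
    (hx : ∀ a, x * a = a * x) (hfix : ∀ δ ∈ H, S.α δ x = x)
    (hsum : ∑ q : (f ⟶ f) ⧸ H, S.α (Groupoid.inv q.out) x = 1) :
    IsSeparableExt (S.subring Δ) := by
  classical
  -- These are the intended values of the section at the local units `1_e`.
  let E : C → RelTensor (S.subring Δ) := fun e =>
    ∑ q : (f ⟶ f) ⧸ H, conjTensor Δ x (Groupoid.inv q.out ≫ g e)
  have hout : ∀ (γ : f ⟶ f) (e : C), conjTensor (S := S) Δ x
      (Groupoid.inv (γ : (f ⟶ f) ⧸ H).out ≫ g e) = conjTensor Δ x (Groupoid.inv γ ≫ g e) := by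
    intro γ e
    obtain ⟨⟨δ, hδ⟩, h⟩ := QuotientGroup.mk_out_eq_mul H γ
    have h' : Groupoid.inv (γ : (f ⟶ f) ⧸ H).out = Groupoid.inv δ ≫ Groupoid.inv γ := by
      rw [h]
      change Groupoid.inv (γ ≫ δ) = _
      simp
    have hδ' : Groupoid.inv δ ∈ H := H.inv_mem hδ
    rw [h', Category.assoc, conjTensor_comp hx (hH _ hδ') (hfix _ hδ')]
  have hE : ∀ {d e : C} (σ : d ⟶ e) (b : A e), leftAct _ (S.single ⟨d, e, σ⟩ b) (E d) =
      rightAct _ (S.single ⟨d, e, σ⟩ b) (E e) := by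
    intro d e σ b
    simp only [E, map_sum]
    -- With this `h`, `h⁻¹` followed by `g e` equals `g d` followed by `σ`, so the reindexing `q ↦ h
    -- q` matches the two sums.
    let h : f ⟶ f := g e ≫ Groupoid.inv σ ≫ Groupoid.inv (g d)
    refine Fintype.sum_equiv (MulAction.toPerm h) _ _ fun q => ?_
    rw [leftAct_conjTensor hΔ hx]
    congr 1
    have h1 : MulAction.toPerm h q = ((h * q.out : f ⟶ f) : (f ⟶ f) ⧸ H) := by
      rw [MulAction.toPerm_apply]
      conv_lhs => rw [← QuotientGroup.out_eq' q]
      rfl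
    rw [h1, hout]
    congr 1
    change _ = Groupoid.inv (h ≫ q.out) ≫ g e
    simp [h]
  have hE0 : ∀ (e : C) (p : Mor C) (_ : p.ran ≠ e) (b : A p.ran),
      rightAct _ (S.single p b) (E e) = 0 := by
    intro e p hp b
    simp only [E, map_sum]
    exact Finset.sum_eq_zero fun q _ => rightAct_conjTensor_of_ne _ hp b
  have hμ : ∀ e, mulMap _ (E e) = S.scalar e 1 := by
    intro e
    have central : ∀ {d : C} (τ : f ⟶ d) (a : A d), S.α τ x * a = a * S.α τ x := by
      intro d τ a
      obtain ⟨a, rfl⟩ := (S.α τ).surjective a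
      rw [← map_mul, hx, map_mul]
    -- In general `α` is multiplicative only up to conjugation by `β`, which is trivial on images of
    -- the central element `x`.
    have h1 : ∀ γ : f ⟶ f, S.α (γ ≫ g e) x = S.α (g e) (S.α γ x) := by
      intro γ
      rw [S.α_comp, ← central, mul_assoc, Units.mul_inv, mul_one]
    simp only [E, map_sum, mulMap_conjTensor, h1]
    rw [← map_one (S.α (g e)), ← hsum, map_sum]
    exact (map_sum (S.single ⟨e, e, 𝟙 e⟩) _ _).symm
  let D : S.CrossedProduct →+ RelTensor (S.subring Δ) :=
    DirectSum.toAddMonoid (β := fun p : Mor C => A p.ran) fun p =>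
      AddMonoidHom.mk' (fun a => leftAct _ (S.single p a) (E p.dom))
        (fun a b => by rw [map_add, leftAct_add])
  have hD : ∀ p a, D (S.single p a) = leftAct _ (S.single p a) (E p.dom) := fun p a =>
    DirectSum.toAddMonoid_of (β := fun p : Mor C => A p.ran) _ p a
  have hD_mul : ∀ (p q : Mor C) (a : A p.ran) (b : A q.ran), D (S.single p a * S.single q b) =
      leftAct _ (S.single p a) (leftAct _ (S.single q b) (E q.dom)) := by
    rintro ⟨e, g, σ⟩ ⟨d, e', τ⟩ a b
    rw [← leftAct_mul]
    by_cases h : e' = e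
    · subst h
      rw [single_mul_single, hD]
    · rw [single_mul_single_of_ne S _ _ h, map_zero, leftAct_zero]
  refine ⟨D, fun y z => ?_, fun y z => ?_, fun y => ?_⟩
  · induction y using induction with
    | h0 => rw [zero_mul, map_zero, leftAct_zero]
    | h2 y y' hy hy' => rw [add_mul, map_add, leftAct_add, hy, hy']
    | h1 p a =>
      induction z using induction with
      | h0 => simp
      | h2 z z' hz hz' => rw [mul_add, map_add, map_add, map_add, hz, hz']
      | h1 q b => rw [hD_mul, hD]
  · induction y using induction with
    | h0 => simp
    | h2 y y' hy hy' => rw [add_mul, map_add, map_add, map_add, hy, hy']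
    | h1 p a =>
      induction z using induction with
      | h0 => rw [mul_zero, map_zero, rightAct_zero]
      | h2 z z' hz hz' => rw [mul_add, map_add, rightAct_add, hz, hz']
      | h1 q b =>
        rw [hD, ← leftAct_rightAct]
        -- In the composable case `E` is moved past `u_q` by `hE`; otherwise `E (p.dom)` times the
        -- second factor vanishes, as does the product.
        by_cases h : q.ran = p.dom
        · rw [hD_mul, hE, ← h]
        · rw [single_mul_single_of_ne S _ _ h, hE0 _ _ h, map_zero, map_zero]
  · induction y using induction with
    | h0 => simp
    | h2 y y' hy hy' => rw [map_add, map_add, hy, hy']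
    | h1 p a => rw [hD, mulMap_leftAct, hμ]; exact mul_scalar_one _ _

end ObjectCrossedSystem

end

theorem mainTheorem6 {K : Type u} {N : Type v} [Field K] [Field N] [Algebra K N]
    (L : IntermediateField K N) [Algebra.IsSeparable K L] [IsNormalClosure K L N]
    (b : ConjCocycle L)
    (Δ : Subgroupoid (ConjField L)) (hΔ : Δ.IsWide)
    (hclosed : ∀ E : ConjField L, IsClosed[E.krull] (Δ.arrows E E)) :
    SepExt.IsSeparableExt (b.system.subring Δ) ↔
      ∃ E : ConjField L, (Δ.vertexSubgroup (Δ.mem_objs_of_src (hΔ.wide E))).FiniteIndex := by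
  constructor
  · intro h
    obtain ⟨E, _, hE⟩ := b.system.exists_finiteIndex_of_isSeparableExt hΔ h (ConjField.base L)
    exact ⟨E, hE⟩
  · rintro ⟨E, hE⟩
    set H := Δ.vertexSubgroup (Δ.mem_objs_of_src (hΔ.wide E))
    have : Fintype ((E ⟶ E) ⧸ H) := Subgroup.fintypeQuotientOfFiniteIndex
    obtain ⟨x, hfix, hsum⟩ := ConjField.exists_fixed_sum_eq_one H (hclosed E)
    -- All objects are conjugates of `L`, so the groupoid is connected and a single object of finite
    -- index suffices.
    exact ObjectCrossedSystem.isSeparableExt_of_sum_eq_one hΔ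
      (fun F => (ConjField.nonempty_hom E F).some) H (fun _ h => h) (mul_comm x) hfix hsum
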